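/- For integers $n\ge 1$ and $k\ge 0$ let $\mathscr I_n\subseteq S_n$ be the set of involutions of $\{1,\dots,n\}$, i.e. of permutations $\sigma$ with $\sigma^2=1$ (including the identity). Let $\mathrm{ris}(\sigma)$ be the number of rises of $\sigma$, i.e. of indices $1\le i\le n-1$ with $\sigma(i)<\sigma(i+1)$. Define the signed Eulerian numbers on involutions by $$f_{n,k}=\sum_{\sigma\in\mathscr I_n,\ \mathrm{ris}(\sigma)=k}\mathrm{sgn}(\sigma).$$ Then, for all $n\ge 1$ and $k\ge 0$, $$f_{n,k}=\sum_{m=0}^{k+1}(-1)^{k-m+1}\binom{n+1}{k-m+1}\sum_{j=0}^{\lfloor n/2\rfloor}(-1)^j\binom{\binom{m+1}{2}+j-1}{j}\binom{m}{n-2j},$$ where $\binom{a}{b}=0$ for integers $0\le a<b$, and $\binom{-1}{0}=1$. -/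

import Mathlib

/-- The set of involutions of the symmetric group on `n` letters: the permutations `σ` with
`σ² = 1` (the identity included). -/
def involutions (n : ℕ) : Finset (Equiv.Perm (Fin n)) :=
  Finset.univ.filter fun σ => σ * σ = 1

/-- The number of rises of `σ`: the number of positions `i` such that `i + 1` is also a position
and `σ i < σ (i + 1)`. -/
def ris {n : ℕ} (σ : Equiv.Perm (Fin n)) : ℕ :=
  (Finset.univ.filter fun i : Fin n => ∃ h : (i : ℕ) + 1 < n, σ i < σ ⟨(i : ℕ) + 1, h⟩).card

/-- The signed Eulerian number on involutions: the sum of the signs of the involutions on `n`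
letters with exactly `k` rises. -/
def signedEulerianInvolution (n k : ℕ) : ℤ :=
  ∑ σ ∈ (involutions n).filter (fun σ => ris σ = k), ((Equiv.Perm.sign σ : ℤˣ) : ℤ)

/-! Write n = N + 1. For a permutation with r rises, the weakly increasing words over m letters that
increase strictly at every rise number C(m + N - r, n). Weighting by sign and summing over
involutions therefore gives a signed count of pairs (σ, a), with a such a word for σ. These pairs
correspond to symmetric multisets of n pairs of letters (symmetric m × m matrices over ℕ with entry
sum n), via (σ, a) ↦ {(a i, a (σ i))}. Fixed points of σ match odd diagonal entries. With j
two-cycles, such a multiset is a set of n - 2j diagonal letters plus a multiset of j unordered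
pairs, and the sign is (-1)^j; this is the inner sum over j (`sum_sign_mul_choose`). Finally ∑ C(m +
N - r, n) X^m = X^(r+1) / (1 - X)^(n+1), so multiplying by (1 - X)^(n+1) and taking the coefficient
of X^(k+1) isolates r = k. -/

/-! ### Binomial inversion by power series. -/

theorem sum_choose_mul_choose_inversion (N k r : ℕ) (hr : r ≤ N) :
    ∑ m ∈ Finset.range (k + 2), (-1 : ℤ) ^ (k + 1 - m) * ((N + 2).choose (k + 1 - m) : ℤ) *
      ((m + (N - r)).choose (N + 1) : ℤ) = if r = k then 1 else 0 := by
  have hsub : ∀ i : ℕ, PowerSeries.coeff i ((1 - PowerSeries.X : PowerSeries ℤ) ^ (N + 2)) =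
      (-1) ^ i * ((N + 2).choose i : ℤ) := by
    intro i
    have h : (1 - PowerSeries.X : PowerSeries ℤ) ^ (N + 2) = PowerSeries.rescale (-1)
        (((1 + Polynomial.X : Polynomial ℤ) ^ (N + 2) : Polynomial ℤ) : PowerSeries ℤ) := by
      simp [sub_eq_add_neg]
    rw [h, PowerSeries.coeff_rescale, Polynomial.coeff_coe, Polynomial.coeff_one_add_X_pow]
  -- The binomial vanishes for m ≤ r, and m + (N - r) = N + 1 + (m - (r + 1)) beyond.
  have hmk : (PowerSeries.mk fun m => ((m + (N - r)).choose (N + 1) : ℤ)) =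
      PowerSeries.X ^ (r + 1) * PowerSeries.mk fun m => ((N + 1 + m).choose (N + 1) : ℤ) := by
    ext m
    rw [PowerSeries.coeff_X_pow_mul', PowerSeries.coeff_mk]
    split_ifs with h
    · rw [PowerSeries.coeff_mk]
      congr 2
      omega
    · rw [Nat.choose_eq_zero_of_lt (by omega)]
      rfl
  have hprod : (PowerSeries.mk fun m => ((m + (N - r)).choose (N + 1) : ℤ)) *
      (1 - PowerSeries.X) ^ (N + 2) = PowerSeries.X ^ (r + 1) := by
    rw [hmk, ← PowerSeries.mk_one_pow_eq_mk_choose_add, mul_assoc, ← mul_pow,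
      PowerSeries.mk_one_mul_one_sub_eq_one, one_pow, mul_one]
  have hc := congrArg (PowerSeries.coeff (k + 1)) hprod
  rw [PowerSeries.coeff_mul, PowerSeries.coeff_X_pow,
    Finset.Nat.sum_antidiagonal_eq_sum_range_succ_mk] at hc
  simp only [PowerSeries.coeff_mk, hsub] at hc
  rw [show (if r = k then (1 : ℤ) else 0) = if k + 1 = r + 1 then 1 else 0 by
    simp [eq_comm], ← hc]
  refine Finset.sum_congr rfl fun m _ => ?_
  ring

/-! ### Words with prescribed strict increases. -/

/-- The number of weakly increasing sequences that increase strictly at the steps in `s`. -/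
theorem card_monotone_strict_at (N m : ℕ) (s : Finset (Fin N)) :
    (Finset.univ.filter fun a : Fin (N + 1) → Fin m =>
      ∀ i : Fin N, a i.castSucc ≤ a i.succ ∧ (i ∈ s → a i.castSucc < a i.succ)).card =
      (m + (N - s.card)).choose (N + 1) := by
  classical
  -- `d i` counts the steps before `i` where equality is allowed. Adding `d` makes every step strict
  -- and stretches the range by N - |s|, so the words become the (N + 1)-subsets of the larger
  -- range.
  set d : Fin (N + 1) → ℕ := fun i => (sᶜ.filter fun q : Fin N => q.castSucc < i).card with hd
  have hd0 : d 0 = 0 := by simp [hd]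
  have hdle : ∀ i, d i ≤ N - s.card := fun i =>
    (Finset.card_filter_le _ _).trans (by rw [Finset.card_compl, Fintype.card_fin])
  have hdlast : d (Fin.last N) = N - s.card := by
    simp only [hd, Fin.castSucc_lt_last, Finset.filter_true, Finset.card_compl, Fintype.card_fin]
  have hds : ∀ q : Fin N, d q.succ = d q.castSucc + if q ∈ s then 0 else 1 := by
    intro q
    simp only [hd]
    split_ifs with hq
    · rw [add_zero]
      congr 1
      ext p
      simp only [Finset.mem_filter, Finset.mem_compl, Fin.castSucc_lt_castSucc_iff,
        Fin.castSucc_lt_succ_iff]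
      refine and_congr_right fun hp => ⟨fun h => lt_of_le_of_ne h ?_, le_of_lt⟩
      rintro rfl
      exact hp hq
    · rw [← Finset.card_insert_of_notMem (a := q) (by simp)]
      congr 1
      ext p
      simp only [Finset.mem_filter, Finset.mem_compl, Fin.castSucc_lt_castSucc_iff,
        Fin.castSucc_lt_succ_iff, Finset.mem_insert, le_iff_eq_or_lt]
      constructor
      · tauto
      · rintro (rfl | h)
        · exact ⟨hq, Or.inl rfl⟩
        · tauto
  have hcard : (Finset.univ : Finset (Fin (N + 1) ↪o Fin (m + (N - s.card)))).card =
      (m + (N - s.card)).choose (N + 1) := by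
    rw [Finset.card_univ, ← Nat.card_eq_fintype_card,
      Nat.card_congr (Set.powersetCard.ofFinEmbEquiv (n := N + 1)), Set.powersetCard.card]
    simp
  rw [← hcard]
  -- Keeps the subtraction b - d in the inverse map from truncating.
  have hb : ∀ b : Fin (N + 1) ↪o Fin (m + (N - s.card)), ∀ i, d i ≤ b i := by
    intro b i
    induction i using Fin.induction with
    | zero => simp [hd0]
    | succ q ih =>
      have h : b q.castSucc < b q.succ := b.strictMono Fin.castSucc_lt_succ
      rw [Fin.lt_def] at h
      have := hds q
      split_ifs at this <;> omega
  have hbd : ∀ b : Fin (N + 1) ↪o Fin (m + (N - s.card)),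
      Monotone fun i => (b i : ℕ) - d i := by
    intro b
    rw [Fin.monotone_iff_le_succ]
    intro q
    have h : b q.castSucc < b q.succ := b.strictMono Fin.castSucc_lt_succ
    rw [Fin.lt_def] at h
    have h1 := hds q
    have h2 := hb b q.castSucc
    split_ifs at h1 <;> omega
  have hlt : ∀ (b : Fin (N + 1) ↪o Fin (m + (N - s.card))) i, (b i : ℕ) - d i < m := by
    intro b i
    refine (hbd b (Fin.le_last i)).trans_lt ?_
    have h1 := hb b (Fin.last N)
    have h2 := (b (Fin.last N)).isLt
    dsimp only
    omega
  refine Finset.card_bij'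
    (fun a ha => OrderEmbedding.ofStrictMono (fun i => ⟨a i + d i, by
        have := (a i).isLt
        have := hdle i
        omega⟩) (by
        rw [Fin.strictMono_iff_lt_succ]
        intro q
        obtain ⟨h1, h2⟩ := (Finset.mem_filter.1 ha).2 q
        have h3 := hds q
        simp only [Fin.lt_def, Fin.le_def] at h1 h2 ⊢
        split_ifs at h3 with hq
        · have := h2 hq
          omega
        · omega))
    (fun b _ i => ⟨b i - d i, hlt b i⟩) (fun _ _ => Finset.mem_univ _) ?_ ?_ ?_
  · intro b _
    refine Finset.mem_filter.2 ⟨Finset.mem_univ _, fun q => ⟨hbd b Fin.castSucc_lt_succ.le, ?_⟩⟩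
    intro hq
    have h : b q.castSucc < b q.succ := b.strictMono Fin.castSucc_lt_succ
    have h1 := hds q
    have h2 := hb b q.castSucc
    rw [if_pos hq] at h1
    simp only [Fin.lt_def] at h ⊢
    omega
  · intro a _
    ext i
    simp
  · intro b _
    ext i
    simp [hb b i]

/-! ### Sorted tuples and multisets. -/

theorem tuple_eq_of_monotone_of_map_eq {n : ℕ} {β : Type*} [PartialOrder β] {f g : Fin n → β}
    (hf : Monotone f) (hg : Monotone g)
    (h : (Finset.univ : Finset (Fin n)).val.map f = (Finset.univ : Finset (Fin n)).val.map g) :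
    f = g := by
  have key : ∀ u : Fin n → β, (Finset.univ : Finset (Fin n)).val.map u = (List.ofFn u : Multiset β) := by
    intro u
    rw [List.ofFn_eq_map]
    rfl
  rw [key, key, Multiset.coe_eq_coe] at h
  exact List.ofFn_injective (h.eq_of_pairwise' hf.sortedLE_ofFn.pairwise hg.sortedLE_ofFn.pairwise)

theorem exists_monotone_tuple {n : ℕ} {β : Type*} [LinearOrder β] (S : Multiset β)
    (hS : S.card = n) :
    ∃ f : Fin n → β, Monotone f ∧ (Finset.univ : Finset (Fin n)).val.map f = S := by
  subst hS
  have hlen : (S.sort (· ≤ ·)).length = S.card := Multiset.length_sort _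
  refine ⟨fun i => (S.sort (· ≤ ·)).get (i.cast hlen.symm), ?_, ?_⟩
  · intro i j hij
    have := (Multiset.pairwise_sort S (· ≤ ·)).sortedLE.monotone_get
    exact this hij
  · conv_rhs => rw [← Multiset.sort_eq S (· ≤ ·)]
    have : (Finset.univ : Finset (Fin S.card)).val = ((List.finRange S.card : List _) : Multiset _) := rfl
    rw [this, Multiset.map_coe]
    congr 1
    rw [← List.ofFn_eq_map]
    refine List.ext_get (by simp) ?_
    intro i h1 h2
    simp

theorem perm_eq_one_of_strictMono {n : ℕ} {σ : Equiv.Perm (Fin n)} (h : StrictMono σ) : σ = 1 := by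
  have := Subsingleton.elim (h.orderIsoOfSurjective _ σ.surjective) (OrderIso.refl _)
  ext i
  exact congrArg Fin.val (DFunLike.congr_fun this i)

/-! ### Involutions with words, and symmetric multisets of pairs. -/

/-- A weakly increasing sequence `a` on whose blocks of constancy `σ` decreases. -/
def DecreasesOnBlocks {n m : ℕ} (σ : Equiv.Perm (Fin n)) (a : Fin n → Fin m) : Prop :=
  Monotone a ∧ ∀ i j, i < j → a i = a j → σ j < σ i

/-- The multiset of the pairs of labels of `i` and `σ i`. -/
def labelPairs {n m : ℕ} (σ : Equiv.Perm (Fin n)) (a : Fin n → Fin m) :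
    Multiset (Fin m × Fin m) :=
  (Finset.univ : Finset (Fin n)).val.map fun i => (a i, a (σ i))

theorem decreasesOnBlocks_iff {N m : ℕ} (σ : Equiv.Perm (Fin (N + 1))) (a : Fin (N + 1) → Fin m) :
    DecreasesOnBlocks σ a ↔ ∀ i : Fin N, a i.castSucc ≤ a i.succ ∧
      (σ i.castSucc < σ i.succ → a i.castSucc < a i.succ) := by
  constructor
  · rintro ⟨h1, h2⟩ i
    refine ⟨h1 Fin.castSucc_lt_succ.le, fun h => ?_⟩
    refine lt_of_le_of_ne (h1 Fin.castSucc_lt_succ.le) fun he => ?_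
    exact absurd h (h2 _ _ Fin.castSucc_lt_succ he).not_gt
  · intro h
    -- Both conditions together say that (a i, σ i) increases lexicographically with the second
    -- coordinate reversed; by transitivity this only needs checking at adjacent positions.
    have hs : StrictMono fun i => toLex (a i, OrderDual.toDual (σ i)) := by
      rw [Fin.strictMono_iff_lt_succ]
      intro i
      rw [Prod.Lex.toLex_lt_toLex]
      obtain ⟨h1, h2⟩ := h i
      rcases h1.lt_or_eq with h3 | h3
      · exact Or.inl h3
      · refine Or.inr ⟨h3, OrderDual.toDual_lt_toDual.2 ?_⟩
        refine lt_of_le_of_ne (not_lt.1 fun h4 => (h2 h4).ne h3) ?_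
        exact fun he => Fin.castSucc_lt_succ.ne' (σ.injective he)
    constructor
    · rw [Fin.monotone_iff_le_succ]
      exact fun i => (h i).1
    · intro i j hij he
      have := hs hij
      rw [Prod.Lex.toLex_lt_toLex] at this
      rcases this with h3 | h3
      · exact absurd he h3.ne
      · exact OrderDual.toDual_lt_toDual.1 h3.2

namespace DecreasesOnBlocks
variable {n m : ℕ}

/-- On a block σ decreases, so a ∘ σ weakly decreases: the pairs are already listed in sorted order
and can be read back from their multiset. -/
theorem monotone_lex {σ : Equiv.Perm (Fin n)} {a : Fin n → Fin m} (h : DecreasesOnBlocks σ a) :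
    Monotone fun i => toLex (a i, OrderDual.toDual (a (σ i))) := by
  intro i j hij
  rcases hij.lt_or_eq with hij | rfl
  · rw [Prod.Lex.toLex_le_toLex]
    rcases (h.1 hij.le).lt_or_eq with h3 | h3
    · exact Or.inl h3
    · exact Or.inr ⟨h3, h.1 (h.2 i j hij h3).le⟩
  · exact le_rfl

/-- Sorting the common multiset recovers a and a ∘ σ = a ∘ τ. If σ and τ ordered the images of i and
j oppositely, monotonicity of a would put these images in one block; the block condition with σ² =
τ² = 1 would then give both j < i and i < j. So τσ is increasing, hence trivial. -/
theorem eq_of_labelPairs_eq {σ τ : Equiv.Perm (Fin n)} {a b : Fin n → Fin m}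
    (hσ : σ * σ = 1) (hτ : τ * τ = 1)
    (ha : DecreasesOnBlocks σ a) (hb : DecreasesOnBlocks τ b)
    (h : labelPairs σ a = labelPairs τ b) : σ = τ ∧ a = b := by
  have hf := tuple_eq_of_monotone_of_map_eq ha.monotone_lex hb.monotone_lex (by
    have := congrArg (Multiset.map fun p : Fin m × Fin m =>
      toLex (p.1, OrderDual.toDual p.2)) h
    simpa [labelPairs, Multiset.map_map, Function.comp_def] using this)
  have hab : a = b := by
    funext i
    exact congrArg (fun p => (ofLex p).1) (congrFun hf i)
  have hst : ∀ i, a (σ i) = a (τ i) := by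
    intro i
    have := congrArg (fun p => OrderDual.ofDual (ofLex p).2) (congrFun hf i)
    rw [hab] at this ⊢
    exact this
  subst hab
  refine ⟨?_, rfl⟩
  have hσσ : ∀ i, σ (σ i) = i := fun i => DFunLike.congr_fun hσ i
  have hττ : ∀ i, τ (τ i) = i := fun i => DFunLike.congr_fun hτ i
  have key : ∀ i j, σ i < σ j → τ i < τ j := by
    intro i j hij
    by_contra hcon
    have hne : τ j ≠ τ i := by
      intro he
      rw [τ.injective he] at hij
      exact lt_irrefl _ hij
    have hlt : τ j < τ i := lt_of_le_of_ne (not_lt.1 hcon) hne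
    have h1 := ha.1 hij.le
    have h2 := ha.1 hlt.le
    rw [← hst, ← hst] at h2
    have h3 := ha.2 _ _ hij (le_antisymm h1 h2)
    have h4 := hb.2 _ _ hlt (by rw [← hst, ← hst]; exact le_antisymm h2 h1)
    rw [hσσ, hσσ] at h3
    rw [hττ, hττ] at h4
    exact lt_asymm h3 h4
  have h1 : τ * σ = 1 := perm_eq_one_of_strictMono fun i j hij =>
    key _ _ (by rwa [hσσ, hσσ])
  exact (mul_left_cancel (h1.trans hτ.symm))

end DecreasesOnBlocks

/-- Sort S, second coordinate reversed, into pairs (a i, b i), and let π sort the positions by b,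
ties taken in decreasing order. The swapped pairs (b (π i), a (π i)) are then sorted too, and by
symmetry they form S again, so b ∘ π = a and a ∘ π = b. -/
theorem exists_decreasesOnBlocks {n m : ℕ} (S : Multiset (Fin m × Fin m)) (hn : S.card = n)
    (hS : S.map Prod.swap = S) :
    ∃ (σ : Equiv.Perm (Fin n)) (a : Fin n → Fin m), σ * σ = 1 ∧ DecreasesOnBlocks σ a ∧
      labelPairs σ a = S := by
  obtain ⟨f, hf, hfS⟩ := exists_monotone_tuple
    (S.map fun p : Fin m × Fin m => toLex (p.1, OrderDual.toDual p.2)) (by simpa using hn)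
  set a : Fin n → Fin m := fun i => (ofLex (f i)).1 with ha
  set b : Fin n → Fin m := fun i => OrderDual.ofDual (ofLex (f i)).2 with hb
  have hfab : f = fun i => toLex (a i, OrderDual.toDual (b i)) := rfl
  have habS : (Finset.univ : Finset (Fin n)).val.map (fun i => (a i, b i)) = S := by
    have := congrArg (Multiset.map fun p : Lex (Fin m × (Fin m)ᵒᵈ) =>
      ((ofLex p).1, OrderDual.ofDual (ofLex p).2)) hfS
    simpa [Multiset.map_map, Function.comp_def] using this
  have hamono : Monotone a := fun i j hij => by
    have := hf hij
    rw [hfab, Prod.Lex.toLex_le_toLex] at this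
    exact this.elim le_of_lt fun h => h.1.le
  set κ : Fin n → Lex (Fin m × (Fin n)ᵒᵈ) := fun i => toLex (b i, OrderDual.toDual i) with hκ
  have hκinj : Function.Injective κ := fun i j h => congrArg (fun p => (ofLex p).2) h
  set π := Tuple.sort κ with hπ
  have hκπ : StrictMono (κ ∘ π) :=
    (Tuple.monotone_sort κ).strictMono_of_injective (hκinj.comp π.injective)
  have hlt : ∀ i j, i < j → b (π i) < b (π j) ∨ b (π i) = b (π j) ∧ π j < π i := by
    intro i j hij
    have := hκπ hij
    rw [Function.comp_apply, Function.comp_apply, hκ, Prod.Lex.toLex_lt_toLex] at this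
    exact this
  have hg : (fun i => toLex (b (π i), OrderDual.toDual (a (π i)))) = f := by
    refine tuple_eq_of_monotone_of_map_eq ?_ hf ?_
    · intro i j hij
      rcases hij.lt_or_eq with hij | rfl
      · rw [Prod.Lex.toLex_le_toLex]
        rcases hlt i j hij with h | h
        · exact Or.inl h
        · exact Or.inr ⟨h.1, hamono h.2.le⟩
      · exact le_rfl
    · rw [hfS]
      have h1 : (Finset.univ : Finset (Fin n)).val.map π = (Finset.univ : Finset (Fin n)).val := by
        exact Multiset.map_univ_val_equiv π
      conv_rhs => rw [← hS, ← habS, ← h1]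
      simp only [Multiset.map_map, Function.comp_def, Prod.swap]
  have hbπ : ∀ i, b (π i) = a i := fun i => congrArg (fun p => (ofLex p).1) (congrFun hg i)
  have haπ : ∀ i, a (π i) = b i := fun i =>
    
    congrArg (fun p : Lex (Fin m × (Fin m)ᵒᵈ) => OrderDual.ofDual (ofLex p).2) (congrFun hg i)
  have hdec : ∀ i j, i < j → a i = a j → π j < π i := by
    intro i j hij he
    rcases hlt i j hij with h | h
    · rw [hbπ, hbπ] at h
      exact absurd he h.ne
    · exact h.2
  refine ⟨π, a, ?_, ⟨hamono, hdec⟩, ?_⟩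
  -- Since a ∘ π² = a, an inversion of π² on i < j forces a i = a j. The block condition then gives
  -- a (π j) < a (π i), and used once more on the images under π² it gives the opposite inequality.
  · refine perm_eq_one_of_strictMono fun i j hij => ?_
    rw [Equiv.Perm.mul_apply, Equiv.Perm.mul_apply]
    by_contra hcon
    have h1 : π (π j) < π (π i) := lt_of_le_of_ne (not_lt.1 hcon) fun he =>
      hij.ne' (π.injective (π.injective he))
    have h2 := hamono h1.le
    rw [haπ, haπ, hbπ, hbπ] at h2
    have he : a i = a j := le_antisymm (hamono hij.le) h2
    have h3 := hdec i j hij he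
    have h4 : a (π j) < a (π i) := lt_of_le_of_ne (hamono h3.le) fun h =>
      lt_asymm h1 (hdec _ _ h3 h)
    have h5 := hdec _ _ h1 (by rw [haπ, haπ, hbπ, hbπ, he])
    have h6 := hamono h5.le
    rw [haπ (π (π i)), hbπ, haπ (π (π j)), hbπ] at h6
    exact h4.not_ge h6
  · rw [labelPairs, ← habS]
    simp only [haπ]

theorem labelPairs_map_swap {n m : ℕ} {σ : Equiv.Perm (Fin n)} (hσ : σ * σ = 1)
    (a : Fin n → Fin m) : (labelPairs σ a).map Prod.swap = labelPairs σ a := by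
  have h1 : (Finset.univ : Finset (Fin n)).val.map σ = (Finset.univ : Finset (Fin n)).val :=
    Multiset.map_univ_val_equiv σ
  have hσσ : ∀ i, σ (σ i) = i := fun i => DFunLike.congr_fun hσ i
  conv_rhs => rw [labelPairs, ← h1]
  simp only [labelPairs, Multiset.map_map, Function.comp_def, Prod.swap, hσσ]

theorem even_card_filter_moved {n : ℕ} {σ : Equiv.Perm (Fin n)} (hσ : σ * σ = 1)
    (s : Finset (Fin n)) (hs : ∀ i ∈ s, σ i ∈ s) : Even (s.filter fun i => σ i ≠ i).card := by
  have hσσ : ∀ i, σ (σ i) = i := fun i => DFunLike.congr_fun hσ i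
  -- Modulo 2 the ones cancel along the two-cycles {i, σ i}.
  rw [← ZMod.natCast_eq_zero_iff_even, Finset.cast_card]
  refine Finset.sum_involution (fun i _ => σ i) (fun i _ => by decide)
    (fun i hi _ => (Finset.mem_filter.1 hi).2) (fun i hi => ?_) (fun i _ => hσσ i)
  obtain ⟨h1, h2⟩ := Finset.mem_filter.1 hi
  exact Finset.mem_filter.2 ⟨hs i h1, fun h => h2 (σ.injective h)⟩

/-- The positions i with a i = a (σ i) = x form a σ-stable set whose moved elements pair off, so the
parity of the diagonal entry is that of the number of fixed points in the block of x. A decreasing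
map fixes at most one point of a block, so a fixed point is present exactly when the entry is odd.
-/
theorem DecreasesOnBlocks.card_fixed {n m : ℕ} {σ : Equiv.Perm (Fin n)} {a : Fin n → Fin m}
    (ha : DecreasesOnBlocks σ a) (hσ : σ * σ = 1) :
    (Finset.univ.filter fun x => Odd ((labelPairs σ a).count (x, x))).card =
      (Finset.univ.filter fun i => σ i = i).card := by
  have hσσ : ∀ i, σ (σ i) = i := fun i => DFunLike.congr_fun hσ i
  have hinj : ∀ i j, σ i = i → σ j = j → a i = a j → i = j := by
    intro i j hi hj he
    by_contra hne
    rcases lt_or_gt_of_ne hne with h | h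
    · have := ha.2 i j h he
      rw [hi, hj] at this
      exact lt_asymm h this
    · have := ha.2 j i h he.symm
      rw [hi, hj] at this
      exact lt_asymm h this
  rw [← Finset.card_image_of_injOn (f := a) (s := Finset.univ.filter fun i => σ i = i)
    (fun i hi j hj he => hinj i j (by simpa using hi) (by simpa using hj) he)]
  congr 1
  ext x
  have hcount : (labelPairs σ a).count (x, x) =
      (Finset.univ.filter fun i => a i = x ∧ a (σ i) = x).card := by
    rw [labelPairs, Multiset.count_map, ← Finset.filter_val, Finset.card_val]
    congr 1
    ext i
    simp [eq_comm]
  have heven := even_card_filter_moved hσ (Finset.univ.filter fun i => a i = x ∧ a (σ i) = x)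
    (by simp only [Finset.mem_filter, Finset.mem_univ, true_and, hσσ]; tauto)
  have hsplit := Finset.card_filter_add_card_filter_not
    (s := Finset.univ.filter fun i => a i = x ∧ a (σ i) = x) (fun i => σ i = i)
  simp only [Finset.mem_filter, Finset.mem_univ, true_and, Finset.mem_image, hcount, ← hsplit]
  rw [Nat.odd_add, iff_true_right heven]
  have hle : ((Finset.univ.filter fun i => a i = x ∧ a (σ i) = x).filter
      fun i => σ i = i).card ≤ 1 := by
    rw [Finset.card_le_one]
    simp only [Finset.mem_filter, Finset.mem_univ, true_and]
    rintro i ⟨⟨h1, -⟩, h2⟩ j ⟨⟨h3, -⟩, h4⟩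
    exact hinj i j h2 h4 (h1.trans h3.symm)
  constructor
  · intro h
    obtain ⟨i, hi⟩ := Finset.card_pos.1 h.pos
    simp only [Finset.mem_filter, Finset.mem_univ, true_and] at hi
    exact ⟨i, hi.2, hi.1.1⟩
  · rintro ⟨i, h1, h2⟩
    have : 0 < ((Finset.univ.filter fun i => a i = x ∧ a (σ i) = x).filter
      fun i => σ i = i).card := Finset.card_pos.2 ⟨i, by simp [h1, h2]⟩
    rw [show _ = 1 from le_antisymm hle this]
    exact odd_one

/-! ### Decomposition of symmetric multisets. -/

/-- The two orientations of an unordered pair, as a multiset. -/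
def orientations {α : Type*} : Sym2 α → Multiset (α × α) :=
  Sym2.lift ⟨fun x y => {(x, y)} + {(y, x)}, fun _ _ => add_comm _ _⟩

/-- The symmetric multiset of pairs whose off-diagonal and diagonal parts are given by the
multiset `T` of unordered pairs, with one more copy of each diagonal pair in `F`. -/
def symmetrization {α : Type*} (F : Finset α) (T : Multiset (Sym2 α)) : Multiset (α × α) :=
  F.val.map (fun x => (x, x)) + T.bind orientations

section
variable {α : Type*}

theorem card_orientations (z : Sym2 α) : (orientations z).card = 2 := by
  induction z with
  | h x y => simp [orientations]

theorem map_swap_orientations (z : Sym2 α) : (orientations z).map Prod.swap = orientations z := by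
  induction z with
  | h x y => simpa [orientations] using Multiset.pair_comm _ _

theorem count_orientations [DecidableEq α] (z : Sym2 α) (x y : α) :
    (orientations z).count (x, y) = if s(x, y) = z then (if x = y then 2 else 1) else 0 := by
  induction z with
  | h u v =>
    simp only [orientations, Sym2.lift_mk, Multiset.count_add, Multiset.count_singleton,
      Prod.mk.injEq, Sym2.eq_iff]
    by_cases h1 : x = u <;> by_cases h2 : y = v <;> by_cases h3 : x = v <;> by_cases h4 : y = u <;>
      by_cases h5 : x = y <;> simp_all

theorem card_symmetrization (F : Finset α) (T : Multiset (Sym2 α)) :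
    (symmetrization F T).card = F.card + 2 * T.card := by
  simp [symmetrization, Multiset.card_bind, card_orientations, mul_comm]

theorem map_swap_symmetrization (F : Finset α) (T : Multiset (Sym2 α)) :
    (symmetrization F T).map Prod.swap = symmetrization F T := by
  simp [symmetrization, Multiset.map_bind, Multiset.map_map,
    map_swap_orientations]

theorem count_symmetrization [DecidableEq α] (F : Finset α) (T : Multiset (Sym2 α)) (x y : α) :
    (symmetrization F T).count (x, y) =
      (if x = y ∧ x ∈ F then 1 else 0) + (if x = y then 2 else 1) * T.count s(x, y) := by
  rw [symmetrization, Multiset.count_add]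
  congr 1
  · by_cases h : x = y
    · subst h
      have hinj : Function.Injective fun x : α => (x, x) := fun a b h => congrArg Prod.fst h
      rw [Multiset.count_map_eq_count' _ _ hinj x, Multiset.count_eq_of_nodup F.nodup]
      simp
    · rw [if_neg (fun h' => h h'.1), Multiset.count_eq_zero]
      simp only [Multiset.mem_map, Prod.mk.injEq, not_exists, not_and]
      rintro u - rfl
      exact h
  · induction T using Multiset.induction_on with
    | empty => simp
    | cons z T ih =>
      rw [Multiset.cons_bind, Multiset.count_add, ih, count_orientations, Multiset.count_cons]
      split_ifs <;> ring

theorem symmetrization_injective [DecidableEq α] {F F' : Finset α} {T T' : Multiset (Sym2 α)}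
    (h : symmetrization F T = symmetrization F' T') : F = F' ∧ T = T' := by
  have hc : ∀ x y, (symmetrization F T).count (x, y) = (symmetrization F' T').count (x, y) :=
    fun x y => by rw [h]
  simp only [count_symmetrization] at hc
  constructor
  · ext x
    have := hc x x
    simp only [true_and, if_true] at this
    by_cases h1 : x ∈ F <;> by_cases h2 : x ∈ F' <;> simp only [h1, h2, if_true, if_false] at this ⊢
      <;> omega
  · ext z
    induction z with
    | h x y =>
      have := hc x y
      by_cases hxy : x = y
      · subst hxy
        simp only [true_and, if_true] at this
        split_ifs at this <;> omega
      · simpa [hxy] using this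

theorem odd_count_symmetrization [DecidableEq α] (F : Finset α) (T : Multiset (Sym2 α)) (x : α) :
    Odd ((symmetrization F T).count (x, x)) ↔ x ∈ F := by
  rw [count_symmetrization]
  by_cases h : x ∈ F
  · simp [h]
  · simp [h]

theorem exists_symmetrization [DecidableEq α] [Fintype α] (S : Multiset (α × α))
    (hS : S.map Prod.swap = S) : ∃ F T, symmetrization F T = S := by
  have hsymm : ∀ x y, S.count (x, y) = S.count (y, x) := by
    intro x y
    conv_lhs => rw [← hS]
    exact Multiset.count_map_eq_count' Prod.swap S Prod.swap_injective (y, x)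
  -- A diagonal unordered pair contributes two copies of (x, x), hence the halving; the odd
  -- remainder is supplied by the set of diagonal letters.
  set c : Sym2 α → ℕ := Sym2.lift
    ⟨fun x y => if x = y then S.count (x, y) / 2 else S.count (x, y), fun x y => by
      simp only [eq_comm, hsymm x y]⟩ with hc
  refine ⟨Finset.univ.filter fun x => Odd (S.count (x, x)), ∑ z : Sym2 α, c z • {z}, ?_⟩
  ext ⟨x, y⟩
  have hT : (∑ z : Sym2 α, c z • ({z} : Multiset (Sym2 α))).count s(x, y) = c s(x, y) := by
    rw [Multiset.count_sum']
    simp [Multiset.count_singleton]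
  rw [count_symmetrization, hT]
  simp only [Finset.mem_filter, Finset.mem_univ, true_and, hc, Sym2.lift_mk]
  by_cases hxy : x = y
  · subst hxy
    simp only [true_and, if_true]
    split_ifs with h
    · have := Nat.odd_iff.1 h
      omega
    · have := Nat.even_iff.1 (Nat.not_odd_iff_even.1 h)
      omega
  · simp [hxy]

end

/-! ### Counting pairs and comparing signs. -/

-- Both sides are compared through their injective images in the multisets of pairs: the pairs (σ,
-- a) on one side, j unordered pairs with n - 2j odd diagonal letters on the other.
open Classical in
theorem card_decreasesOnBlocks_with_fixed (n m j : ℕ) (hj : 2 * j ≤ n) :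
    (Finset.univ.filter fun p : Equiv.Perm (Fin n) × (Fin n → Fin m) =>
      p.1 * p.1 = 1 ∧ DecreasesOnBlocks p.1 p.2 ∧
        (Finset.univ.filter fun i => p.1 i = i).card = n - 2 * j).card =
      ((m + 1).choose 2 + j - 1).choose j * m.choose (n - 2 * j) := by
  have hB : ((Finset.univ : Finset (Sym (Sym2 (Fin m)) j)) ×ˢ
      Finset.powersetCard (n - 2 * j) (Finset.univ : Finset (Fin m))).card =
      ((m + 1).choose 2 + j - 1).choose j * m.choose (n - 2 * j) := by
    rw [Finset.card_product, Finset.card_powersetCard, Finset.card_univ,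
      Sym.card_sym_eq_choose, Sym2.card, Finset.card_univ, Fintype.card_fin]
  rw [← hB, ← Finset.card_image_of_injOn (f := fun p : Equiv.Perm (Fin n) × (Fin n → Fin m) =>
      labelPairs p.1 p.2), ← Finset.card_image_of_injOn
      (f := fun q : Sym (Sym2 (Fin m)) j × Finset (Fin m) => symmetrization q.2 q.1.1)]
  · congr 1
    ext S
    simp only [Finset.mem_image, Finset.mem_filter, Finset.mem_univ, true_and,
      Finset.mem_product, Finset.mem_powersetCard, Finset.subset_univ, Prod.exists]
    constructor
    · rintro ⟨σ, a, ⟨h1, h2, h3⟩, rfl⟩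
      obtain ⟨F, T, hFT⟩ := exists_symmetrization _ (labelPairs_map_swap h1 a)
      have hF := h2.card_fixed h1
      simp only [← hFT, odd_count_symmetrization, h3] at hF
      rw [Finset.filter_univ_mem] at hF
      have hc := card_symmetrization F T
      rw [hFT, labelPairs, Multiset.card_map, Finset.card_val, Finset.card_univ,
        Fintype.card_fin] at hc
      exact ⟨⟨T, by omega⟩, F, hF, hFT⟩
    · rintro ⟨T, F, hF, rfl⟩
      obtain ⟨σ, a, h1, h2, h3⟩ := exists_decreasesOnBlocks (n := n) (symmetrization F T.1)
        (by rw [card_symmetrization, hF, T.2]; omega) (map_swap_symmetrization _ _)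
      refine ⟨σ, a, ⟨h1, h2, ?_⟩, h3⟩
      rw [← h2.card_fixed h1, h3]
      simp only [odd_count_symmetrization]
      rw [Finset.filter_univ_mem, hF]
  · rintro ⟨T, F⟩ - ⟨T', F'⟩ - h
    obtain ⟨h1, h2⟩ := symmetrization_injective h
    exact Prod.ext (Subtype.ext h2) h1
  · rintro ⟨σ, a⟩ h ⟨τ, b⟩ h' he
    simp only [Finset.coe_filter, Finset.mem_univ, true_and, Set.mem_ofPred_eq] at h h'
    obtain ⟨h1, h2⟩ := h.2.1.eq_of_labelPairs_eq h.1 h'.1 h'.2.1 he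
    exact Prod.ext h1 h2

open Classical in
theorem card_decreasesOnBlocks {N m : ℕ} (σ : Equiv.Perm (Fin (N + 1))) :
    (Finset.univ.filter fun a : Fin (N + 1) → Fin m => DecreasesOnBlocks σ a).card =
      (m + (N - ris σ)).choose (N + 1) := by
  have hris : ris σ = (Finset.univ.filter fun i : Fin N => σ i.castSucc < σ i.succ).card := by
    rw [ris, ← Finset.card_map (s := Finset.univ.filter fun i : Fin N => _) Fin.castSuccEmb]
    refine congrArg Finset.card (Finset.ext fun i => ?_)
    simp only [Finset.mem_filter, Finset.mem_univ, true_and, Finset.mem_map]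
    constructor
    · rintro ⟨h, h'⟩
      exact ⟨⟨i, by omega⟩, h', rfl⟩
    · rintro ⟨q, hq, rfl⟩
      exact ⟨Nat.succ_lt_succ q.isLt, hq⟩
  rw [hris, ← card_monotone_strict_at]
  congr 1
  ext a
  simp [decreasesOnBlocks_iff]

theorem ris_le {N : ℕ} (σ : Equiv.Perm (Fin (N + 1))) : ris σ ≤ N := by
  have h : (Finset.univ.filter fun i : Fin (N + 1) =>
      ∃ h : (i : ℕ) + 1 < N + 1, σ i < σ ⟨(i : ℕ) + 1, h⟩) ⊆ Finset.univ.erase (Fin.last N) := by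
    intro i hi
    obtain ⟨h, -⟩ := (Finset.mem_filter.1 hi).2
    refine Finset.mem_erase.2 ⟨?_, Finset.mem_univ _⟩
    rintro rfl
    simp at h
  simpa [ris] using Finset.card_le_card h

theorem card_fixed_add_card_moved {n : ℕ} (σ : Equiv.Perm (Fin n)) :
    (Finset.univ.filter fun i => σ i = i).card + (Finset.univ.filter fun i => σ i ≠ i).card = n := by
  rw [Finset.card_filter_add_card_filter_not, Finset.card_univ, Fintype.card_fin]

theorem sign_of_card_fixed {n j : ℕ} {σ : Equiv.Perm (Fin n)} (hσ : σ * σ = 1) (hj : 2 * j ≤ n)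
    (h : (Finset.univ.filter fun i => σ i = i).card = n - 2 * j) :
    ((Equiv.Perm.sign σ : ℤˣ) : ℤ) = (-1) ^ j := by
  have hfix : Fintype.card (Function.fixedPoints σ) =
      (Finset.univ.filter fun i => σ i = i).card := Fintype.card_subtype _
  rw [Equiv.Perm.sign_of_pow_two_eq_one (by rw [sq, hσ]), hfix, h, Fintype.card_fin,
    Nat.sub_sub_self hj, Nat.mul_div_cancel_left _ two_pos]
  simp

theorem sum_sign_mul_choose (N m : ℕ) :
    ∑ σ ∈ involutions (N + 1), ((Equiv.Perm.sign σ : ℤˣ) : ℤ) *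
        ((m + (N - ris σ)).choose (N + 1) : ℤ) =
      ∑ j ∈ Finset.range ((N + 1) / 2 + 1), (-1 : ℤ) ^ j *
        (((m + 1).choose 2 + j - 1).choose j : ℤ) * (m.choose (N + 1 - 2 * j) : ℤ) := by
  classical
  have hmoved : ∀ σ : Equiv.Perm (Fin (N + 1)), σ * σ = 1 →
      Even (Finset.univ.filter fun i => σ i ≠ i).card := fun σ hσ =>
    even_card_filter_moved hσ Finset.univ fun _ _ => Finset.mem_univ _
  have h1 : ∑ σ ∈ involutions (N + 1), ((Equiv.Perm.sign σ : ℤˣ) : ℤ) *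
        ((m + (N - ris σ)).choose (N + 1) : ℤ) =
      ∑ p ∈ (Finset.univ.filter fun p : Equiv.Perm (Fin (N + 1)) × (Fin (N + 1) → Fin m) =>
        p.1 * p.1 = 1 ∧ DecreasesOnBlocks p.1 p.2), ((Equiv.Perm.sign p.1 : ℤˣ) : ℤ) := by
    rw [Finset.sum_filter, Fintype.sum_prod_type, involutions, Finset.sum_filter]
    refine Finset.sum_congr rfl fun σ _ => ?_
    split_ifs with h
    · simp only [h, true_and]
      rw [← Finset.sum_filter, Finset.sum_const, card_decreasesOnBlocks, nsmul_eq_mul, mul_comm]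
    · simp [h]
  -- Half the number of moved points is the number j of two-cycles, on which the sign depends.
  rw [h1, ← Finset.sum_fiberwise_of_maps_to (t := Finset.range ((N + 1) / 2 + 1))
    (g := fun p => (Finset.univ.filter fun i => p.1 i ≠ i).card / 2)]
  · refine Finset.sum_congr rfl fun j hj => ?_
    have hj2 : 2 * j ≤ N + 1 := by
      have := Finset.mem_range.1 hj
      omega
    rw [mul_assoc, ← Nat.cast_mul, ← card_decreasesOnBlocks_with_fixed _ _ _ hj2, mul_comm,
      ← nsmul_eq_mul, ← Finset.sum_const, Finset.filter_filter]
    refine Finset.sum_congr ?_ fun p hp => ?_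
    · ext ⟨σ, a⟩
      simp only [Finset.mem_filter, Finset.mem_univ, true_and, and_assoc]
      refine and_congr_right fun h => and_congr_right fun _ => ?_
      have h2 := card_fixed_add_card_moved σ
      obtain ⟨c, hc⟩ := hmoved σ h
      omega
    · obtain ⟨-, h, -, hc⟩ := Finset.mem_filter.1 hp
      exact sign_of_card_fixed h hj2 hc
  · rintro ⟨σ, a⟩ -
    have h2 := card_fixed_add_card_moved σ
    rw [Finset.mem_range]
    dsimp only
    omega

theorem theorem3 (n k : ℕ) (hn : 1 ≤ n) :
    signedEulerianInvolution n k =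
      ∑ m ∈ Finset.range (k + 2),
        (-1 : ℤ) ^ (k + 1 - m) * ((n + 1).choose (k + 1 - m) : ℤ) *
          ∑ j ∈ Finset.range (n / 2 + 1),
            (-1 : ℤ) ^ j * (((m + 1).choose 2 + j - 1).choose j : ℤ) *
              (m.choose (n - 2 * j) : ℤ) := by
  obtain ⟨N, rfl⟩ := Nat.exists_eq_add_of_le' hn
  simp only [← sum_sign_mul_choose, Finset.mul_sum]
  rw [Finset.sum_comm, signedEulerianInvolution, Finset.sum_filter]
  refine Finset.sum_congr rfl fun σ _ => ?_
  have h := sum_choose_mul_choose_inversion N k (ris σ) (ris_le σ)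
  rw [← mul_boole, ← h, Finset.mul_sum]
  refine Finset.sum_congr rfl fun m _ => ?_
  ring
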